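/- **Setting.** A dynamical linear bandit (DLB) with state dimension $n$, action space $\mathcal U\subseteq\mathbb R^d$ and state space $\mathcal X\subseteq\mathbb R^n$ starts in a state $x_1\in\mathcal X$. In round $t=1,2,\dots$ the learner plays $u_t\in\mathcal U$, receives the reward $y_t=\langle\omega,x_t\rangle+\langle\theta,u_t\rangle+\eta_t$, and the state becomes $x_{t+1}=Ax_t+Bu_t+\varepsilon_t\in\mathcal X$, where $\eta_t$ and $\varepsilon_t$ are independent of the past and of each other, have mean zero and are $\sigma^2$-subgaussian. A (possibly stochastic) policy $\pi$ chooses, in every round $t$, the law of $u_t$ given everything observed so far; here we allow even policies that observe the states, so that $u_t$ may depend on $x_1,u_1,y_1,\dots,x_{t-1},u_{t-1},y_{t-1},x_t$ (policies to which the states are hidden are a special case). Put $J(\pi)=\liminf_{H\to\infty}\mathbb E\big[\frac1H\sum_{t=1}^H y_t\big]$, write $J(u)$ for the policy that always plays $u$, let $J^*$ be the maximum of $J$ over all policies, and let $\mathbb E R(\pi,T)=\mathbb E\big[TJ^*-\sum_{t=1}^T y_t\big]$ be the expected regret. Let $\rho(A)$ be the spectral radius of $A$, $\|\cdot\|_2$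 the Euclidean or spectral norm, and $\Phi(A)=\sup_{\tau\ge0}\|A^\tau\|_2/\rho(A)^\tau$ (with $0/0=0$). *Stability assumption:* $\rho(A)<1$ and $\Phi(A)<\infty$. *Boundedness assumption:* $\|\theta\|_2\le\Theta$, $\|\omega\|_2\le\Omega$, $\|B\|_2\le \overline B$, $\sup_{u\in\mathcal U}\|u\|_2\le \overline U$, $\sup_{x\in\mathcal X}\|x\|_2\le \overline X$ and $\sup_{u\in\mathcal U}|J(u)|\le1$. **Theorem (Lower Bound).** There are universal constants $c,C>0$ such that the following holds for all $d\ge1$, all $\rho\in[0,1)$ and all $T\in\mathbb N$ with $$T\ge C\,\frac{d^2}{1-\rho}.$$ For every (even stochastic) policy $\pi$ for the action space $\mathcal U=\{-1,1\}^d$ and observed states in $\mathbb R^d$ there is a DLB with $n=d$, this action space and $\rho(A)=\rho$, in which $J^*$ exists and is attained by a constant action, such that the expected regret of $\pi$ is well defined and $$\mathbb E R(\pi,T)\ \ge\ c\,\frac{d\sqrt T}{(1-\rho(A))^{1/2}} .$$ The DLB satisfies the stability assumption and the boundedness assumption with $\Theta=\Omega=\overline U=\sqrt d$, $\overline B=1-\rho$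 and some $\overline X<\infty$, has $x_1=0$ and $\sigma^2=1$, and its $A$ is diagonal with entries in $\{\rho,\rho-\epsilon\}$ for some $0\le\epsilon\le\rho$. The same holds with Gaussian noise $\eta_t\sim\mathcal N(0,1)$, $\varepsilon_t\sim\mathcal N(0,I_d)$ in place of the bound $\overline X$ on the states (with Gaussian noise the states are unbounded). -/

import Mathlib

open MeasureTheory ProbabilityTheory Filter
open scoped NNReal ENNReal

noncomputable section

/-- `ℝᵏ` with the Euclidean norm. -/
abbrev Vec (k : ℕ) : Type := EuclideanSpace ℝ (Fin k)

/-- The action set `{-1, 1}ᵈ`. -/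
def hypercube (d : ℕ) : Set (Vec d) := {u | ∀ i, u i = -1 ∨ u i = 1}

/-- The linear map `v ↦ M v` between Euclidean spaces. Its operator norm is the spectral norm
of the matrix. -/
def matCLM {m k : ℕ} (M : Matrix (Fin m) (Fin k) ℝ) : Vec k →L[ℝ] Vec m :=
  LinearMap.toContinuousLinearMap (Matrix.toEuclideanLin M)

/-- The spectral radius: the largest modulus of a complex eigenvalue. -/
def specRad {n : ℕ} (A : Matrix (Fin n) (Fin n) ℝ) : ℝ≥0∞ :=
  spectralRadius ℂ (A.map (algebraMap ℝ ℂ))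

/-- `Φ(A) = sup_{τ ≥ 0} ‖A ^ τ‖₂ / ρ(A) ^ τ`, in `[0, ∞]`, with `0 / 0 = 0`
and `c / 0 = ∞` for `c > 0`. -/
def Phi {n : ℕ} (A : Matrix (Fin n) (Fin n) ℝ) : ℝ≥0∞ :=
  ⨆ τ : ℕ, ‖matCLM (A ^ τ)‖ₑ / specRad A ^ τ

/-- A dynamical linear bandit with state dimension `n`, action space `U ⊆ ℝᵈ` and i.i.d. noise:
`y_t = ⟨ω, x_t⟩ + ⟨θ, u_t⟩ + η_t` and `x_{t+1} = A x_t + B u_t + ε_t`, where the `η_t` and the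
`ε_t` are independent, zero-mean and `σ²`-subgaussian, with laws `rewardNoise` and `stateNoise`. -/
structure DLB (n d : ℕ) (U : Set (Vec d)) where
  /-- the state space `𝒳` -/
  stateSpace : Set (Vec n)
  /-- the initial state -/
  x₁ : Vec n
  /-- the dynamic matrix -/
  A : Matrix (Fin n) (Fin n) ℝ
  /-- the action-state matrix -/
  B : Matrix (Fin n) (Fin d) ℝ
  /-- the weight of the state in the reward -/
  ω : Vec n
  /-- the weight of the action in the reward -/
  θ : Vec d
  /-- the subgaussianity parameter -/
  σ : ℝ≥0
  /-- the law of the reward noise -/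
  rewardNoise : Measure ℝ
  /-- the law of the state noise -/
  stateNoise : Measure (Vec n)
  prob_rewardNoise : IsProbabilityMeasure rewardNoise
  prob_stateNoise : IsProbabilityMeasure stateNoise
  mean_rewardNoise : ∫ η, η ∂rewardNoise = 0
  mean_stateNoise : ∫ ε, ε ∂stateNoise = 0
  subgaussian_rewardNoise : HasSubgaussianMGF (fun η : ℝ => η) (σ ^ 2) rewardNoise
  subgaussian_stateNoise : ∀ ζ : Vec n,
    HasSubgaussianMGF (fun ε : Vec n => inner ℝ ζ ε) (‖ζ‖₊ ^ 2 * σ ^ 2) stateNoise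
  init_mem : x₁ ∈ stateSpace
  step_mem : ∀ x ∈ stateSpace, ∀ u ∈ U, ∀ᵐ ε ∂stateNoise,
    matCLM A x + matCLM B u + ε ∈ stateSpace

/-- What is recorded of the first `t` rounds: the triples `(x_s, u_s, y_s)` of state, action
and reward. -/
abbrev History (n d : ℕ) (U : Set (Vec d)) (t : ℕ) : Type := Fin t → Vec n × U × ℝ

/-- A (possibly stochastic) policy of a learner who observes states and rewards: for every round,
the law of the action given the past states, actions and rewards and the current state.
A learner to whom the states are hidden uses a policy whose kernels ignore the state components,
a deterministic learner uses deterministic kernels. -/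
structure Policy (n d : ℕ) (U : Set (Vec d)) where
  /-- the law of the next action, when `t` rounds have been completed -/
  act : ∀ t : ℕ, Kernel (History n d U t × Vec n) U
  markov : ∀ t, IsMarkovKernel (act t)

/-- The policy that always plays the action `u`. -/
def Policy.const {n d : ℕ} {U : Set (Vec d)} (u : U) : Policy n d U where
  act _ := Kernel.const _ (Measure.dirac u)
  markov _ := inferInstance

namespace DLB

variable {n d : ℕ} {U : Set (Vec d)}

/-- One round: from the history and the current state, the action played, the reward noise and
the state noise to the extended history and the next state. -/
def step (D : DLB n d U) (t : ℕ) (p : ((History n d U t × Vec n) × U) × (ℝ × Vec n)) :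
    History n d U (t + 1) × Vec n :=
  let h := p.1.1.1
  let x := p.1.1.2
  let u := p.1.2
  let η := p.2.1
  let ε := p.2.2
  (Fin.snoc (α := fun _ => Vec n × U × ℝ) h
      (x, u, inner ℝ D.ω x + inner ℝ D.θ (u : Vec d) + η),
    matCLM D.A x + matCLM D.B (u : Vec d) + ε)

/-- The joint law of the history of the first `t` rounds and of the state that follows them,
when the policy `π` is played. -/
def law (D : DLB n d U) (π : Policy n d U) : (t : ℕ) → Measure (History n d U t × Vec n)
  | 0 => Measure.dirac (Fin.elim0, D.x₁)
  | t + 1 => (((law D π t).compProd (π.act t)).prod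
      (D.rewardNoise.prod D.stateNoise)).map (D.step t)

/-- The sum of the rewards of the first `t` rounds. -/
def totalReward {t : ℕ} (p : History n d U t × Vec n) : ℝ := ∑ s : Fin t, (p.1 s).2.2

/-- The infinite-horizon expected average reward
`J(π) = liminf_{H → ∞} E[(1 / H) ∑_{t = 1}^H y_t]`. -/
def J (D : DLB n d U) (π : Policy n d U) : EReal :=
  liminf (fun H : ℕ => ((∫ p, (1 / (H : ℝ)) * totalReward p ∂(D.law π H) : ℝ) : EReal)) atTop

/-- An optimal policy maximizes the expected average reward. -/
def IsOptimal (D : DLB n d U) (π : Policy n d U) : Prop := ∀ π' : Policy n d U, D.J π' ≤ D.J π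

/-- The regret `T J* - ∑_{t = 1}^T y_t`, as a function of what happened in the first `T` rounds. -/
def regret (Jstar : ℝ) (T : ℕ) (p : History n d U T × Vec n) : ℝ := T * Jstar - totalReward p

/-- The expected regret of `π` over the horizon `T` is defined and is at least `b`. Here `J*` is
the performance of an optimal policy, and this optimal policy may be taken constant; so `J*` is the
same number whether one optimizes over all policies above, over the deterministic ones, or over
those that do not see the state. -/
def ExpectedRegretAtLeast (D : DLB n d U) (π : Policy n d U) (T : ℕ) (b : ℝ) : Prop :=
  ∃ (u : U) (Jstar : ℝ), D.IsOptimal (Policy.const u) ∧ D.J (Policy.const u) = (Jstar : EReal) ∧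
    Integrable (regret Jstar T) (D.law π T) ∧
    b ≤ ∫ p, regret Jstar T p ∂(D.law π T)

/-- The stability assumption. -/
def Stable (D : DLB n d U) : Prop := specRad D.A < 1 ∧ Phi D.A < ⊤

/-- The boundedness assumption, except for the bound on the states. -/
def ParameterBounds (D : DLB n d U) (Θ Ω B R : ℝ) : Prop :=
  ‖D.θ‖ ≤ Θ ∧ ‖D.ω‖ ≤ Ω ∧ ‖matCLM D.B‖ ≤ B ∧ (∀ u ∈ U, ‖u‖ ≤ R) ∧
    ∀ u : U, -1 ≤ D.J (Policy.const u) ∧ D.J (Policy.const u) ≤ 1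

/-- The bound on the states in the boundedness assumption. -/
def StateBound (D : DLB n d U) (X : ℝ) : Prop := ∀ x ∈ D.stateSpace, ‖x‖ ≤ X

/-- The reward noise is `N(0, 1)`, the state noise is `N(0, I)`. -/
def StandardGaussianNoise (D : DLB n d U) : Prop :=
  D.rewardNoise = gaussianReal 0 1 ∧ D.stateNoise = stdGaussian (Vec n)

/-- `A` is diagonal with entries in `{ρ, ρ - ε}` for some `0 ≤ ε ≤ ρ`. -/
def DiagonalDynamics (D : DLB n d U) (ρ : ℝ) : Prop :=
  ∃ (ε : ℝ) (a : Fin n → ℝ), 0 ≤ ε ∧ ε ≤ ρ ∧ (∀ i, a i = ρ ∨ a i = ρ - ε) ∧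
    D.A = Matrix.diagonal a

/-- The properties shared by the hard instances: stability, spectral radius `ρ`, diagonal dynamics,
the parameter bounds `‖θ‖, ‖ω‖, sup ‖u‖ ≤ √d`, `‖B‖ ≤ 1 - ρ` and `sup |J(u)| ≤ 1`,
initial state `0`, and `1`-subgaussian noise. -/
def IsHardInstance (D : DLB n d U) (ρ : ℝ) : Prop :=
  D.Stable ∧ specRad D.A = ENNReal.ofReal ρ ∧ D.DiagonalDynamics ρ ∧
    D.ParameterBounds (√d) (√d) (1 - ρ) (√d) ∧ D.x₁ = 0 ∧ D.σ = 1

end DLB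

end

/-!
The dynamics of all hard instances are `A = ρ I`; what the learner does not know is the sign
pattern `s` in `B = δ diag(s)`. The reward is the sum of the coordinates of the state (plus noise),
so in the long run the `i`-th coordinate of an action earns `δ / (1 - ρ)` per round if it agrees
with `s i` and loses as much otherwise. The best policy plays `s` constantly, and every
disagreement costs `2 δ / (1 - ρ)`.

The sign `s i` shows only in the state transitions: reversing it shifts the next state by `2δ`
along the `i`-th axis, in Gaussian noise of variance `1`. The choice `δ = √(1 - ρ) / (4 √T)` keeps
`T δ²` bounded, so that after `T` rounds the two laws of the history are not separated. Hence the
policy errs a constant fraction of the time in every coordinate, on average over `s`, and the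
regret is of order `T d δ / (1 - ρ) = d √T / (4 √(1 - ρ))`. The condition on `T` makes
`d δ ≤ 1 - ρ`, which gives the bounds on `B` and on `J`, and makes the initial phase, in which the
states have not yet reached their stationary mean, negligible.

Three ingredients carry this.

* Information. Closeness of laws `P'`, `P` is measured by the inequality
  `(∫ f dP')² ≤ K ∫ f² dP + E` for measurable `f` with values in `[0, 1]`. For `E = 0` it says that
  `dP'/dP` has squared `L²(P)`-norm at most `K`, but it needs no densities, and it composes along
  the rounds (`DLB.sq_lintegral_law_le`). For one round it is the Cauchy-Schwarz inequality for
  the Gaussian shift density (`sq_lintegral_stdGaussian_shift_le`).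
* Bounded states. The Gaussian noise is replaced by its cutoff, which moves the mass far away to the
  origin. The cutoff noise is symmetric, bounded and still `1`-subgaussian, because the cutoff
  decreases `cosh` pointwise; the inequality above survives with an arbitrarily small `E`
  (`shiftRegular_cutoffGaussian`).
* Rewards. The total reward plus `(⟨ω, x⟩ - ∑ ⟨ω, B u_s⟩) / (1 - ρ)` is a martingale
  (`DLB.integral_totalReward`), and `⟨ω, x⟩` has bounded expectation. This gives `J` for the
  constant policies, the optimality of one of them, and the regret.
-/

open scoped Topology

/-! ### Shifts of the standard Gaussian law -/

/-- Jensen's inequality for the square. -/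
theorem sq_lintegral_le {α : Type*} [MeasurableSpace α] (μ : Measure α) [IsProbabilityMeasure μ]
    {f : α → ℝ≥0∞} (hf : Measurable f) : (∫⁻ x, f x ∂μ) ^ 2 ≤ ∫⁻ x, f x ^ 2 ∂μ := by
  have h := ENNReal.lintegral_mul_le_Lp_mul_Lq μ Real.HolderConjugate.two_two hf.aemeasurable
    (aemeasurable_const (b := (1 : ℝ≥0∞)))
  simp only [Pi.mul_apply, mul_one, ENNReal.one_rpow, lintegral_const, measure_univ] at h
  calc (∫⁻ x, f x ∂μ) ^ 2 ≤ ((∫⁻ x, f x ^ (2 : ℝ) ∂μ) ^ (1 / 2 : ℝ)) ^ 2 := by gcongr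
    _ = ∫⁻ x, f x ^ 2 ∂μ := by
      rw [← ENNReal.rpow_natCast, ← ENNReal.rpow_mul]; norm_num

/-- The Cauchy-Schwarz inequality. -/
theorem sq_lintegral_mul_le {α : Type*} [MeasurableSpace α] (μ : Measure α)
    {f g : α → ℝ≥0∞} (hf : Measurable f) (hg : Measurable g) :
    (∫⁻ x, g x * f x ∂μ) ^ 2 ≤ (∫⁻ x, g x ^ 2 ∂μ) * ∫⁻ x, f x ^ 2 ∂μ := by
  have h := ENNReal.lintegral_mul_le_Lp_mul_Lq μ Real.HolderConjugate.two_two hg.aemeasurable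
    hf.aemeasurable
  simp only [Pi.mul_apply] at h
  calc (∫⁻ x, g x * f x ∂μ) ^ 2
      ≤ ((∫⁻ x, g x ^ (2 : ℝ) ∂μ) ^ (1 / 2 : ℝ) * (∫⁻ x, f x ^ (2 : ℝ) ∂μ) ^ (1 / 2 : ℝ)) ^ 2 := by
        gcongr
    _ = _ := by
      rw [mul_pow, ← ENNReal.rpow_natCast, ← ENNReal.rpow_mul, ← ENNReal.rpow_natCast,
        ← ENNReal.rpow_mul]
      norm_num

/-- The Cameron-Martin formula on the line. -/
theorem lintegral_gaussianReal_shift (c : ℝ) {f : ℝ → ℝ≥0∞} (hf : Measurable f) :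
    ∫⁻ z, f (c + z) ∂gaussianReal 0 1 =
      ∫⁻ z, ENNReal.ofReal (Real.exp (c * z - c ^ 2 / 2)) * f z ∂gaussianReal 0 1 := by
  have h1 : ∫⁻ z, f (c + z) ∂gaussianReal 0 1 = ∫⁻ z, f z ∂gaussianReal c 1 := by
    have := gaussianReal_map_const_add (μ := 0) (v := 1) c
    rw [zero_add] at this
    rw [← this, lintegral_map hf (by fun_prop)]
  rw [h1, gaussianReal_of_var_ne_zero _ one_ne_zero, gaussianReal_of_var_ne_zero _ one_ne_zero,
    lintegral_withDensity_eq_lintegral_mul _ (measurable_gaussianPDF _ _) hf,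
    lintegral_withDensity_eq_lintegral_mul _ (measurable_gaussianPDF _ _) (by fun_prop)]
  refine lintegral_congr fun z => ?_
  simp only [Pi.mul_apply, gaussianPDF, ← mul_assoc]
  rw [← ENNReal.ofReal_mul (gaussianPDFReal_nonneg _ _ _)]
  congr 2
  simp only [gaussianPDFReal, mul_assoc, ← Real.exp_add]
  congr 3
  push_cast; ring

theorem sq_lintegral_gaussianReal_shift_le (c : ℝ) {f : ℝ → ℝ≥0∞} (hf : Measurable f) :
    (∫⁻ z, f (c + z) ∂gaussianReal 0 1) ^ 2 ≤
      ENNReal.ofReal (Real.exp (c ^ 2)) * ∫⁻ z, f z ^ 2 ∂gaussianReal 0 1 := by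
  rw [lintegral_gaussianReal_shift c hf]
  refine (sq_lintegral_mul_le _ hf (by fun_prop)).trans_eq ?_
  congr 1
  -- the second moment of the shift density by `c` is `exp (c²)` times the mass of the one by `2c`
  have h := lintegral_gaussianReal_shift (2 * c) (f := fun _ => 1) measurable_const
  simp only [lintegral_const, measure_univ, mul_one] at h
  rw [← mul_one (ENNReal.ofReal (Real.exp (c ^ 2))), h, ← lintegral_const_mul _ (by fun_prop)]
  refine lintegral_congr fun z => ?_
  rw [← ENNReal.ofReal_pow (Real.exp_nonneg _), ← ENNReal.ofReal_mul (Real.exp_nonneg _),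
    ← Real.exp_add, ← Real.exp_nat_mul]
  congr 2
  push_cast; ring

/-- A shift along a coordinate axis concerns only one factor of the product law; the other
coordinates are averaged over by Jensen's inequality. -/
theorem sq_lintegral_stdGaussian_shift_le {d : ℕ} (i : Fin d) (c : ℝ) {f : Vec d → ℝ≥0∞}
    (hf : Measurable f) :
    (∫⁻ z, f (EuclideanSpace.single i c + z) ∂stdGaussian (Vec d)) ^ 2 ≤
      ENNReal.ofReal (Real.exp (c ^ 2)) * ∫⁻ z, f z ^ 2 ∂stdGaussian (Vec d) := by
  cases d with
  | zero => exact i.elim0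
  | succ n =>
    have key : ∀ g : Vec (n + 1) → ℝ≥0∞, Measurable g → ∫⁻ z, g z ∂stdGaussian (Vec (n + 1)) =
        ∫⁻ r, ∫⁻ x, g (WithLp.toLp 2 (i.insertNth x r)) ∂gaussianReal 0 1
          ∂Measure.pi fun _ : Fin n => gaussianReal 0 1 := by
      intro g hg
      have hm := ((measurePreserving_piFinSuccAbove
        (fun _ : Fin (n + 1) => gaussianReal 0 1) i).symm)
      have hins : Measurable fun p : ℝ × (Fin n → ℝ) =>
          (i.insertNth p.1 p.2 : Fin (n + 1) → ℝ) := hm.measurable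
      have hg' : Measurable fun p : ℝ × (Fin n → ℝ) =>
          g (WithLp.toLp 2 (i.insertNth p.1 p.2)) :=
        hg.comp ((by fun_prop : Measurable (WithLp.toLp 2 : (Fin (n + 1) → ℝ) → _)).comp hins)
      rw [← map_pi_eq_stdGaussian, lintegral_map hg (by fun_prop), ← hm.map_eq,
        lintegral_map (by fun_prop) hm.measurable]
      exact lintegral_prod_symm _ hg'.aemeasurable
    have hins : Measurable fun p : (Fin n → ℝ) × ℝ =>
        (WithLp.toLp 2 (i.insertNth p.2 p.1 : Fin (n + 1) → ℝ) : Vec (n + 1)) := by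
      have := ((measurePreserving_piFinSuccAbove
        (fun _ : Fin (n + 1) => gaussianReal 0 1) i).symm).measurable
      exact (by fun_prop : Measurable (WithLp.toLp 2 : (Fin (n + 1) → ℝ) → _)).comp
        (this.comp measurable_swap)
    have hsh : ∀ (x : ℝ) (r : Fin n → ℝ), EuclideanSpace.single i c +
        WithLp.toLp 2 (i.insertNth x r : Fin (n + 1) → ℝ) =
        WithLp.toLp 2 (i.insertNth (c + x) r : Fin (n + 1) → ℝ) := by
      intro x r
      ext j
      refine Fin.succAboveCases i ?_ (fun j => ?_) j <;> simp [Fin.succAbove_ne]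
    have hslice : ∀ r, Measurable fun x => f (WithLp.toLp 2 (i.insertNth x r)) := fun r =>
      (hf.comp hins).comp (measurable_const.prodMk measurable_id)
    rw [key _ (by fun_prop), key _ (by fun_prop)]
    simp only [hsh]
    have hadd : Measurable fun p : (Fin n → ℝ) × ℝ => (p.1, c + p.2) := by fun_prop
    calc _ ≤ ∫⁻ r, (∫⁻ x, f (WithLp.toLp 2 (i.insertNth (c + x) r)) ∂gaussianReal 0 1) ^ 2
          ∂Measure.pi fun _ : Fin n => gaussianReal 0 1 :=
          sq_lintegral_le _ (((hf.comp hins).comp hadd).lintegral_prod_right')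
      _ ≤ ∫⁻ r, ENNReal.ofReal (Real.exp (c ^ 2)) *
          ∫⁻ x, f (WithLp.toLp 2 (i.insertNth x r)) ^ 2 ∂gaussianReal 0 1
          ∂Measure.pi fun _ : Fin n => gaussianReal 0 1 :=
          lintegral_mono fun r => sq_lintegral_gaussianReal_shift_le c (hslice r)
      _ = _ := lintegral_const_mul _ (((hf.comp hins).pow_const 2).lintegral_prod_right')

/-- Every shift of `ν` by a vector `c eᵢ` with `|c| ≤ r` satisfies
`(∫ f d(τ ν))² ≤ k ∫ f² dν + e` for all measurable `f` with values in `[0, 1]`. For `e = 0` this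
says that the shifted law has a density of squared `L²(ν)`-norm at most `k`. -/
def ShiftRegular {d : ℕ} (ν : Measure (Vec d)) (r : ℝ) (k e : ℝ≥0∞) : Prop :=
  ∀ (i : Fin d) (c : ℝ), |c| ≤ r → ∀ f : Vec d → ℝ≥0∞, Measurable f → (∀ z, f z ≤ 1) →
    (∫⁻ z, f (EuclideanSpace.single i c + z) ∂ν) ^ 2 ≤ k * ∫⁻ z, f z ^ 2 ∂ν + e

theorem shiftRegular_stdGaussian {d : ℕ} (r : ℝ) :
    ShiftRegular (stdGaussian (Vec d)) r (ENNReal.ofReal (Real.exp (r ^ 2))) 0 := by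
  intro i c hc f hf _
  rw [add_zero]
  refine (sq_lintegral_stdGaussian_shift_le i c hf).trans ?_
  gcongr ENNReal.ofReal (Real.exp ?_) * _
  exact sq_le_sq' (abs_le.1 hc).1 (abs_le.1 hc).2

theorem hasSubgaussianMGF_inner_stdGaussian {d : ℕ} (ζ : Vec d) :
    HasSubgaussianMGF (fun ε : Vec d => inner ℝ ζ ε) (‖ζ‖₊ ^ 2) (stdGaussian (Vec d)) := by
  have hmap : (stdGaussian (Vec d)).map (fun ε : Vec d => inner ℝ ζ ε) =
      gaussianReal 0 (‖ζ‖₊ ^ 2) := by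
    have h := IsGaussian.map_eq_gaussianReal (μ := stdGaussian (Vec d)) (innerSL ℝ ζ)
    rw [integral_strongDual_stdGaussian, variance_dual_stdGaussian, innerSL_apply_norm] at h
    have h2 : (‖ζ‖ ^ 2).toNNReal = ‖ζ‖₊ ^ 2 := by
      rw [← coe_nnnorm, ← NNReal.coe_pow, Real.toNNReal_coe]
    rw [h2] at h
    exact h
  refine ⟨fun t => ?_, fun t => ?_⟩
  · have h := integrable_exp_mul_gaussianReal (μ := 0) (v := ‖ζ‖₊ ^ 2) t
    rw [← hmap, integrable_map_measure (by fun_prop) (by fun_prop)] at h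
    exact h
  · rw [mgf_gaussianReal hmap]
    simp

theorem map_neg_stdGaussian {d : ℕ} :
    (stdGaussian (Vec d)).map (fun z => -z) = stdGaussian (Vec d) :=
  stdGaussian_map (LinearIsometryEquiv.neg ℝ (E := Vec d))

theorem integral_comp_neg_stdGaussian {d : ℕ} {E : Type*} [NormedAddCommGroup E]
    [NormedSpace ℝ E] (f : Vec d → E) :
    ∫ z, f (-z) ∂stdGaussian (Vec d) = ∫ z, f z ∂stdGaussian (Vec d) := by
  conv_rhs => rw [← map_neg_stdGaussian]
  exact ((MeasurableEquiv.neg (Vec d)).measurableEmbedding.integral_map f).symm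

/-! ### Gaussian noise with a cutoff -/

/-- The map that sends all vectors of norm larger than `L` to `0`. -/
noncomputable def cutoff {d : ℕ} (L : ℝ) (z : Vec d) : Vec d := if ‖z‖ ≤ L then z else 0

theorem measurable_cutoff {d : ℕ} (L : ℝ) : Measurable (cutoff L : Vec d → Vec d) :=
  Measurable.ite (measurableSet_le measurable_norm measurable_const) measurable_id
    measurable_const

theorem cutoff_neg {d : ℕ} (L : ℝ) (z : Vec d) : cutoff L (-z) = -cutoff L z := by
  unfold cutoff
  split_ifs <;> simp_all

theorem norm_cutoff_le {d : ℕ} {L : ℝ} (hL : 0 ≤ L) (z : Vec d) : ‖cutoff L z‖ ≤ L := by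
  unfold cutoff
  split_ifs with h
  · exact h
  · simpa using hL

/-- The standard Gaussian law with the mass outside the ball of radius `L` moved to the origin. -/
noncomputable def cutoffGaussian (d : ℕ) (L : ℝ) : Measure (Vec d) :=
  (stdGaussian (Vec d)).map (cutoff L)

instance {d : ℕ} {L : ℝ} : IsProbabilityMeasure (cutoffGaussian d L) :=
  Measure.isProbabilityMeasure_map (measurable_cutoff L).aemeasurable

theorem integral_id_cutoffGaussian (d : ℕ) (L : ℝ) : ∫ z, z ∂cutoffGaussian d L = 0 := by
  rw [cutoffGaussian, integral_map (measurable_cutoff L).aemeasurable (by fun_prop)]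
  have h := integral_comp_neg_stdGaussian (d := d) (cutoff L)
  simp only [cutoff_neg, integral_neg] at h
  have : IsAddTorsionFree (Vec d) := .of_isTorsionFree ℝ _
  exact self_eq_neg.1 h.symm

theorem hasSubgaussianMGF_inner_cutoffGaussian {d : ℕ} (L : ℝ) (ζ : Vec d) :
    HasSubgaussianMGF (fun ε : Vec d => inner ℝ ζ ε) (‖ζ‖₊ ^ 2) (cutoffGaussian d L) := by
  have hG := hasSubgaussianMGF_inner_stdGaussian ζ
  have hm := measurable_cutoff (d := d) L
  have hint : ∀ t : ℝ, Integrable (fun z : Vec d => Real.exp (t * inner ℝ ζ (cutoff L z)))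
      (stdGaussian (Vec d)) := by
    intro t
    refine ((hG.integrable_exp_mul t).add (integrable_const 1)).mono' (by fun_prop) ?_
    refine Eventually.of_forall fun z => ?_
    rw [Real.norm_of_nonneg (Real.exp_nonneg _), Pi.add_apply]
    unfold cutoff
    split_ifs
    · linarith
    · simp [Real.exp_nonneg]
  refine ⟨fun t => ?_, fun t => ?_⟩
  · rw [cutoffGaussian, integrable_map_measure (by fun_prop) hm.aemeasurable]
    exact hint t
  · refine le_trans ?_ (hG.mgf_le t)
    -- Both laws are symmetric, so `exp` may be replaced by `cosh`, which the cutoff decreases.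
    have hsymm : ∀ g : Vec d → Vec d, (∀ z, g (-z) = -g z) →
        (∀ s : ℝ, Integrable (fun z => Real.exp (s * inner ℝ ζ (g z))) (stdGaussian (Vec d))) →
        ∫ z, Real.exp (t * inner ℝ ζ (g z)) ∂stdGaussian (Vec d) =
          ∫ z, Real.cosh (t * inner ℝ ζ (g z)) ∂stdGaussian (Vec d) := by
      intro g hg hi
      have h1 := integral_comp_neg_stdGaussian
        (fun z => Real.exp (t * inner ℝ ζ (g z)))
      simp only [hg, inner_neg_right, mul_neg] at h1
      have h2 := hi (-t)
      simp only [neg_mul] at h2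
      simp only [Real.cosh_eq]
      rw [integral_div, integral_add (hi t) h2, h1]
      ring
    have hcosh : ∀ g : Vec d → Vec d,
        (∀ s : ℝ, Integrable (fun z => Real.exp (s * inner ℝ ζ (g z))) (stdGaussian (Vec d))) →
        Integrable (fun z => Real.cosh (t * inner ℝ ζ (g z))) (stdGaussian (Vec d)) := by
      intro g hi
      have h2 := hi (-t)
      simp only [neg_mul] at h2
      simp only [Real.cosh_eq]
      exact ((hi t).add h2).div_const 2
    have hid := hsymm id (fun _ => rfl) hG.integrable_exp_mul
    simp only [id] at hid
    rw [mgf, mgf, cutoffGaussian, integral_map hm.aemeasurable (by fun_prop),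
      hsymm _ (cutoff_neg L) hint, hid]
    refine integral_mono (hcosh _ hint) (hcosh id hG.integrable_exp_mul) fun z => ?_
    unfold cutoff
    split_ifs
    · exact le_rfl
    · simp

theorem lintegral_stdGaussian_le_add_compl_closedBall {d : ℕ} (L : ℝ) {f g : Vec d → ℝ≥0∞} (hg : Measurable g)
    (hfg : ∀ z, ‖z‖ ≤ L → f z = g z) (hf1 : ∀ z, f z ≤ 1) :
    ∫⁻ z, f z ∂stdGaussian (Vec d) ≤
      ∫⁻ z, g z ∂stdGaussian (Vec d) + stdGaussian (Vec d) (Metric.closedBall 0 L)ᶜ := by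
  have hs : MeasurableSet (Metric.closedBall (0 : Vec d) L)ᶜ :=
    Metric.isClosed_closedBall.measurableSet.compl
  rw [← lintegral_indicator_one hs, ← lintegral_add_left hg]
  refine lintegral_mono fun z => ?_
  by_cases hz : ‖z‖ ≤ L
  · rw [hfg z hz]; exact le_self_add
  · have : z ∈ (Metric.closedBall (0 : Vec d) L)ᶜ := by simpa using hz
    rw [Set.indicator_of_mem this]
    exact (hf1 z).trans (by simp)

theorem shiftRegular_cutoffGaussian {d : ℕ} (L r : ℝ) :
    ShiftRegular (cutoffGaussian d L) r (ENNReal.ofReal (Real.exp (r ^ 2)))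
      ((ENNReal.ofReal (Real.exp (r ^ 2)) + 3) *
        stdGaussian (Vec d) (Metric.closedBall 0 L)ᶜ) := by
  intro i c hc f hf hf1
  have hm := measurable_cutoff (d := d) L
  set k := ENNReal.ofReal (Real.exp (r ^ 2))
  set p := stdGaussian (Vec d) (Metric.closedBall 0 L)ᶜ
  have hp : p ≤ 1 := prob_le_one
  rw [cutoffGaussian, lintegral_map (by fun_prop) hm, lintegral_map (by fun_prop) hm]
  have h1 := lintegral_stdGaussian_le_add_compl_closedBall L
    (f := fun z => f (EuclideanSpace.single i c + cutoff L z))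
    (g := fun z => f (EuclideanSpace.single i c + z)) (by fun_prop)
    (fun z hz => by simp [cutoff, hz]) fun _ => hf1 _
  have h2 := lintegral_stdGaussian_le_add_compl_closedBall L (f := fun z => f z ^ 2)
    (g := fun z => f (cutoff L z) ^ 2) (by fun_prop)
    (fun z hz => by simp [cutoff, hz]) fun _ => pow_le_one₀ zero_le (hf1 _)
  have h3 := shiftRegular_stdGaussian r i c hc f hf hf1
  rw [add_zero] at h3
  have hX : ∫⁻ z, f (EuclideanSpace.single i c + z) ∂stdGaussian (Vec d) ≤ 1 :=
    (lintegral_mono fun _ => hf1 _).trans (by simp)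
  set X := ∫⁻ z, f (EuclideanSpace.single i c + z) ∂stdGaussian (Vec d)
  calc _ ≤ (X + p) ^ 2 := by gcongr
    _ = X ^ 2 + 2 * X * p + p * p := by ring
    _ ≤ k * (∫⁻ z, f (cutoff L z) ^ 2 ∂stdGaussian (Vec d) + p) + 2 * 1 * p + 1 * p := by
        gcongr
        exact h3.trans (by gcongr)
    _ = _ := by ring

theorem exists_stdGaussian_compl_closedBall_le (d : ℕ) {q : ℝ≥0∞} (hq : 0 < q) :
    ∃ L : ℝ, 0 ≤ L ∧ stdGaussian (Vec d) (Metric.closedBall 0 L)ᶜ ≤ q := by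
  obtain ⟨K, hK, hKq⟩ := (isTightMeasureSet_iff_exists_isCompact_measure_compl_le.1
    (isTightMeasureSet_singleton (μ := stdGaussian (Vec d)))) q hq
  obtain ⟨L, hL⟩ := hK.isBounded.subset_closedBall 0
  refine ⟨max L 0, le_max_right _ _, le_trans (measure_mono ?_) (hKq _ rfl)⟩
  exact Set.compl_subset_compl.2 (hL.trans (Metric.closedBall_subset_closedBall (le_max_left _ _)))

namespace DLB

variable {n d : ℕ} {U : Set (Vec d)}

attribute [instance] DLB.prob_rewardNoise DLB.prob_stateNoise Policy.markov

/-! ### The law of the interaction -/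

theorem measurable_step (D : DLB n d U) (t : ℕ) : Measurable (D.step t) := by
  refine Measurable.prodMk ?_ ?_
  · refine measurable_pi_iff.2 fun s => ?_
    refine Fin.lastCases ?_ (fun s => ?_) s
    · simp only [Fin.snoc_last]
      fun_prop
    · simp only [Fin.snoc_castSucc]
      fun_prop
  · fun_prop

/-- The joint law of everything that enters round `t`: history, state, action, and both noises. -/
noncomputable def roundLaw (D : DLB n d U) (π : Policy n d U) (t : ℕ) :
    Measure (((History n d U t × Vec n) × U) × (ℝ × Vec n)) :=
  ((D.law π t).compProd (π.act t)).prod (D.rewardNoise.prod D.stateNoise)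

theorem law_succ (D : DLB n d U) (π : Policy n d U) (t : ℕ) :
    D.law π (t + 1) = (D.roundLaw π t).map (D.step t) := rfl

instance (D : DLB n d U) (π : Policy n d U) (t : ℕ) : IsProbabilityMeasure (D.law π t) := by
  induction t with
  | zero => exact inferInstanceAs (IsProbabilityMeasure (Measure.dirac _))
  | succ t ih => exact Measure.isProbabilityMeasure_map (D.measurable_step t).aemeasurable

instance (D : DLB n d U) (π : Policy n d U) (t : ℕ) : IsProbabilityMeasure (D.roundLaw π t) :=
  inferInstanceAs (IsProbabilityMeasure (Measure.prod _ _))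

theorem lintegral_law_succ (D : DLB n d U) (π : Policy n d U) (t : ℕ)
    {f : History n d U (t + 1) × Vec n → ℝ≥0∞} (hf : Measurable f) :
    ∫⁻ p, f p ∂D.law π (t + 1) = ∫⁻ w, ∫⁻ u, ∫⁻ z, f (D.step t ((w, u), z))
      ∂(D.rewardNoise.prod D.stateNoise) ∂π.act t w ∂D.law π t := by
  have hg : Measurable fun q => f (D.step t q) := hf.comp (D.measurable_step t)
  rw [law_succ, lintegral_map hf (D.measurable_step t), roundLaw, lintegral_prod _ hg.aemeasurable,
    Measure.lintegral_compProd hg.lintegral_prod_right']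

/-- If one round of `D'` is comparable with one round of `D`, uniformly over the past and the
action, then so are `t` rounds, with the constants multiplied. -/
theorem sq_lintegral_law_le (D D' : DLB n d U) (π : Policy n d U) (hx : D'.x₁ = D.x₁)
    {k e : ℝ≥0∞} (hk : 1 ≤ k)
    (hstep : ∀ t w, ∀ f : History n d U (t + 1) × Vec n → ℝ≥0∞, Measurable f → (∀ p, f p ≤ 1) →
      (∫⁻ z, f (D'.step t (w, z)) ∂(D'.rewardNoise.prod D'.stateNoise)) ^ 2 ≤
        k * ∫⁻ z, f (D.step t (w, z)) ^ 2 ∂(D.rewardNoise.prod D.stateNoise) + e)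
    (t : ℕ) (f : History n d U t × Vec n → ℝ≥0∞) (hf : Measurable f) (hf1 : ∀ p, f p ≤ 1) :
    (∫⁻ p, f p ∂D'.law π t) ^ 2 ≤ k ^ t * ∫⁻ p, f p ^ 2 ∂D.law π t + t * k ^ t * e := by
  induction t with
  | zero =>
    simp only [law, hx]
    rw [lintegral_dirac' _ hf, lintegral_dirac' _ (by fun_prop)]
    simp
  | succ t ih =>
    rw [lintegral_law_succ _ _ _ hf, lintegral_law_succ _ _ _ (hf.pow_const 2)]
    have hF : Measurable fun w : (History n d U t × Vec n) × U => ∫⁻ z, f (D'.step t (w, z))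
        ∂(D'.rewardNoise.prod D'.stateNoise) :=
      (hf.comp (D'.measurable_step t)).lintegral_prod_right'
    have hF2 : Measurable fun w : (History n d U t × Vec n) × U => ∫⁻ z, f (D.step t (w, z)) ^ 2
        ∂(D.rewardNoise.prod D.stateNoise) :=
      ((hf.pow_const 2).comp (D.measurable_step t)).lintegral_prod_right'
    have hG1 : ∀ w, ∫⁻ u, ∫⁻ z, f (D'.step t ((w, u), z))
        ∂(D'.rewardNoise.prod D'.stateNoise) ∂π.act t w ≤ 1 := fun w =>
      (lintegral_mono fun u => lintegral_mono fun z => hf1 _).trans (by simp)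
    refine (ih _ hF.lintegral_kernel_prod_right' hG1).trans ?_
    have hinner : ∀ w, (∫⁻ u, ∫⁻ z, f (D'.step t ((w, u), z))
          ∂(D'.rewardNoise.prod D'.stateNoise) ∂π.act t w) ^ 2 ≤
        k * (∫⁻ u, ∫⁻ z, f (D.step t ((w, u), z)) ^ 2
          ∂(D.rewardNoise.prod D.stateNoise) ∂π.act t w) + e := by
      intro w
      refine (sq_lintegral_le _ (hF.comp measurable_prodMk_left)).trans ?_
      refine (lintegral_mono fun u => hstep t (w, u) f hf hf1).trans_eq ?_
      have hF2w : Measurable fun u => ∫⁻ z, f (D.step t ((w, u), z)) ^ 2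
          ∂(D.rewardNoise.prod D.stateNoise) := hF2.comp measurable_prodMk_left
      rw [lintegral_add_right _ measurable_const, lintegral_const_mul _ hF2w]
      simp
    calc _ ≤ k ^ t * ∫⁻ w, (k * (∫⁻ u, ∫⁻ z, f (D.step t ((w, u), z)) ^ 2
          ∂(D.rewardNoise.prod D.stateNoise) ∂π.act t w) + e) ∂D.law π t + t * k ^ t * e := by
          exact add_le_add (mul_le_mul' le_rfl (lintegral_mono hinner)) le_rfl
      _ = k ^ (t + 1) * ∫⁻ w, (∫⁻ u, ∫⁻ z, f (D.step t ((w, u), z)) ^ 2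
          ∂(D.rewardNoise.prod D.stateNoise) ∂π.act t w) ∂D.law π t
            + (t + 1) * k ^ t * e := by
          rw [lintegral_add_right _ measurable_const,
            lintegral_const_mul _ hF2.lintegral_kernel_prod_right', lintegral_const, measure_univ]
          ring
      _ ≤ _ := by
          push_cast
          gcongr
          exact Nat.le_succ t

/-! ### Expected rewards under scalar dynamics -/

/-- The sum of `⟨ω, B u_s⟩` over the rounds played. -/
noncomputable def inputSum (D : DLB n d U) {t : ℕ} (p : History n d U t × Vec n) : ℝ :=
  ∑ s : Fin t, inner ℝ D.ω (matCLM D.B ((p.1 s).2.1 : Vec d))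

theorem measurable_totalReward {t : ℕ} :
    Measurable (totalReward : History n d U t × Vec n → ℝ) := by
  unfold totalReward; fun_prop

theorem measurable_inputSum (D : DLB n d U) {t : ℕ} :
    Measurable (D.inputSum : History n d U t × Vec n → ℝ) := by
  unfold inputSum; fun_prop

theorem totalReward_step (D : DLB n d U) (t : ℕ)
    (q : ((History n d U t × Vec n) × U) × (ℝ × Vec n)) :
    totalReward (D.step t q) = totalReward q.1.1 +
      (inner ℝ D.ω q.1.1.2 + inner ℝ D.θ (q.1.2 : Vec d) + q.2.1) := by
  simp [totalReward, step, Fin.sum_univ_castSucc]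

theorem inputSum_step (D : DLB n d U) (t : ℕ)
    (q : ((History n d U t × Vec n) × U) × (ℝ × Vec n)) :
    D.inputSum (D.step t q) = D.inputSum q.1.1 + inner ℝ D.ω (matCLM D.B (q.1.2 : Vec d)) := by
  simp [inputSum, step, Fin.sum_univ_castSucc]

theorem integrable_stateNoise_inner (D : DLB n d U) (ζ : Vec n) :
    Integrable (fun ε => inner ℝ ζ ε) D.stateNoise :=
  (D.subgaussian_stateNoise ζ).integrable

theorem integrable_stateNoise (D : DLB n d U) : Integrable (fun ε => ε) D.stateNoise := by
  have h : ∀ i, Integrable (fun ε : Vec n => ε i) D.stateNoise := fun i => by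
    simpa [EuclideanSpace.inner_single_left] using
      D.integrable_stateNoise_inner (EuclideanSpace.single i 1)
  have h2 := integrable_finsetSum Finset.univ fun i _ =>
    (h i).smul_const (EuclideanSpace.single i (1 : ℝ) : Vec n)
  refine h2.congr (Eventually.of_forall fun ε => ?_)
  ext j
  simp [Finset.sum_apply, Pi.single_apply]

theorem integral_stateNoise_inner (D : DLB n d U) (ζ : Vec n) :
    ∫ ε, inner ℝ ζ ε ∂D.stateNoise = 0 := by
  have := (innerSL ℝ ζ).integral_comp_comm D.integrable_stateNoise
  simp only [innerSL_apply_apply] at this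
  rw [this, D.mean_stateNoise, inner_zero_right]

section Scalar

variable (D : DLB n d U) (π : Policy n d U) {ρ b : ℝ}

/-- The expectation of a function that changes in one round by a function of the past and a
function of the noise. -/
theorem integral_law_succ {t : ℕ} {F : History n d U (t + 1) × Vec n → ℝ} (hF : Measurable F)
    {G : (History n d U t × Vec n) × U → ℝ} {N : ℝ × Vec n → ℝ}
    (hFG : ∀ q, F (D.step t q) = G q.1 + N q.2)
    (hG : Integrable G ((D.law π t).compProd (π.act t)))
    (hN : Integrable N (D.rewardNoise.prod D.stateNoise)) :
    Integrable F (D.law π (t + 1)) ∧ ∫ p, F p ∂D.law π (t + 1) =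
      ∫ w, G w ∂((D.law π t).compProd (π.act t)) +
        ∫ z, N z ∂(D.rewardNoise.prod D.stateNoise) := by
  have hG' : Integrable (fun q => G q.1) (D.roundLaw π t) := hG.comp_fst _
  have hN' : Integrable (fun q => N q.2) (D.roundLaw π t) := hN.comp_snd _
  have hm := (D.measurable_step t).aemeasurable (μ := D.roundLaw π t)
  rw [law_succ, integrable_map_measure hF.aestronglyMeasurable hm,
    integral_map hm hF.aestronglyMeasurable]
  simp only [Function.comp_def, hFG]
  refine ⟨hG'.add hN', ?_⟩
  rw [integral_add hG' hN']
  congr 1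
  · rw [roundLaw, integral_fun_fst]; simp
  · rw [roundLaw, integral_fun_snd]; simp

theorem integrable_comp_fst_compProd {t : ℕ} {g : History n d U t × Vec n → ℝ}
    (hg : Integrable g (D.law π t)) :
    Integrable (fun w => g w.1) ((D.law π t).compProd (π.act t)) ∧
      ∫ w, g w.1 ∂((D.law π t).compProd (π.act t)) = ∫ p, g p ∂D.law π t := by
  have h : ((D.law π t).compProd (π.act t)).map Prod.fst = D.law π t := Measure.fst_compProd _ _
  have hg' := hg
  rw [← h] at hg'
  refine ⟨(integrable_map_measure hg'.aestronglyMeasurable measurable_fst.aemeasurable).1 hg', ?_⟩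
  rw [← integral_map measurable_fst.aemeasurable hg'.aestronglyMeasurable, h]

variable {D}

/-- The recursion `m ↦ ρ m + O(b)` for the expectation `m` of `⟨ω, x⟩` preserves the bound
`|m| ≤ b / (1 - ρ)`. -/
theorem integrable_inner_state (hA : ∀ x, matCLM D.A x = ρ • x)
    (hB : ∀ u ∈ U, |inner ℝ D.ω (matCLM D.B u)| ≤ b) (hx : D.x₁ = 0) (hρ : 0 ≤ ρ) (hρ1 : ρ < 1)
    (hb : 0 ≤ b) (t : ℕ) :
    Integrable (fun p : History n d U t × Vec n => inner ℝ D.ω p.2) (D.law π t) ∧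
      |∫ p, inner ℝ D.ω p.2 ∂D.law π t| ≤ b / (1 - ρ) := by
  have h1ρ : 0 < 1 - ρ := by linarith
  induction t with
  | zero =>
    simp only [law]
    refine ⟨integrable_dirac (by finiteness), ?_⟩
    rw [integral_dirac' _ _ (by fun_prop)]
    simpa [hx] using div_nonneg hb h1ρ.le
  | succ t ih =>
    obtain ⟨ih1, ih2⟩ := ih
    obtain ⟨i1, i2⟩ := integrable_comp_fst_compProd D π ih1
    have hb' : ∀ w : (History n d U t × Vec n) × U,
        ‖(inner ℝ D.ω (matCLM D.B (w.2 : Vec d)) : ℝ)‖ ≤ b := fun w => hB _ w.2.2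
    have i3 : Integrable (fun w : (History n d U t × Vec n) × U =>
        (inner ℝ D.ω (matCLM D.B (w.2 : Vec d)) : ℝ)) ((D.law π t).compProd (π.act t)) :=
      Integrable.of_bound (by fun_prop) b (Eventually.of_forall hb')
    have iN : Integrable (fun z : ℝ × Vec n => (inner ℝ D.ω z.2 : ℝ))
        (D.rewardNoise.prod D.stateNoise) := (D.integrable_stateNoise_inner D.ω).comp_snd _
    obtain ⟨j1, j2⟩ := integral_law_succ D π
      (F := fun p => inner ℝ D.ω p.2)
      (G := fun w => ρ * inner ℝ D.ω w.1.2 + inner ℝ D.ω (matCLM D.B (w.2 : Vec d)))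
      (N := fun z => inner ℝ D.ω z.2) (by fun_prop)
      (fun q => by simp [step, hA, inner_add_right, inner_smul_right]) ((i1.const_mul ρ).add i3) iN
    refine ⟨j1, ?_⟩
    rw [j2, integral_add (i1.const_mul ρ) i3, integral_const_mul, i2, integral_fun_snd,
      D.integral_stateNoise_inner]
    have h4 := norm_integral_le_of_norm_le_const (μ := (D.law π t).compProd (π.act t))
      (Eventually.of_forall hb')
    rw [Real.norm_eq_abs, probReal_univ, mul_one] at h4
    simp only [smul_zero, add_zero]
    refine (abs_add_le _ _).trans ?_
    rw [abs_mul, abs_of_nonneg hρ]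
    have : ρ * (b / (1 - ρ)) + b = b / (1 - ρ) := by field_simp; ring
    nlinarith [mul_le_mul_of_nonneg_left ih2 hρ]

theorem integrable_inputSum (hB : ∀ u ∈ U, |inner ℝ D.ω (matCLM D.B u)| ≤ b) (t : ℕ) :
    Integrable (D.inputSum : History n d U t × Vec n → ℝ) (D.law π t) := by
  refine Integrable.of_bound D.measurable_inputSum.aestronglyMeasurable (t * b)
    (Eventually.of_forall fun p => ?_)
  refine (norm_sum_le _ _).trans ((Finset.sum_le_sum fun s _ => hB _ (p.1 s).2.1.2).trans_eq ?_)
  simp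

/-- With `θ = 0` and `A = ρ I`, the total reward plus `(⟨ω, x⟩ - ∑ ⟨ω, B u_s⟩) / (1 - ρ)` is a
martingale, since its increments are combinations of the noises. -/
theorem integral_totalReward (hA : ∀ x, matCLM D.A x = ρ • x) (hθ : D.θ = 0)
    (hB : ∀ u ∈ U, |inner ℝ D.ω (matCLM D.B u)| ≤ b) (hx : D.x₁ = 0) (hρ : 0 ≤ ρ) (hρ1 : ρ < 1)
    (hb : 0 ≤ b) (t : ℕ) :
    Integrable (totalReward : History n d U t × Vec n → ℝ) (D.law π t) ∧
      ∫ p, totalReward p ∂D.law π t = (∫ p, D.inputSum p ∂D.law π t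
        - ∫ p, inner ℝ D.ω p.2 ∂D.law π t) / (1 - ρ) := by
  have h1ρ : 1 - ρ ≠ 0 := by linarith
  have key : Integrable (fun p : History n d U t × Vec n => totalReward p +
        (1 - ρ)⁻¹ * (inner ℝ D.ω p.2 - D.inputSum p)) (D.law π t) ∧
      ∫ p, (totalReward p + (1 - ρ)⁻¹ * (inner ℝ D.ω p.2 - D.inputSum p)) ∂D.law π t = 0 := by
    induction t with
    | zero =>
      simp only [law]
      refine ⟨integrable_dirac (by finiteness), ?_⟩
      rw [integral_dirac']
      · simp [hx, totalReward, inputSum]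
      · have := measurable_totalReward (n := n) (U := U) (t := 0)
        have := D.measurable_inputSum (t := 0)
        exact Measurable.stronglyMeasurable (by fun_prop)
    | succ t ih =>
      obtain ⟨i1, i2⟩ := integrable_comp_fst_compProd D π ih.1
      have k1 : Integrable (fun z : ℝ × Vec n => z.1) (D.rewardNoise.prod D.stateNoise) :=
        Integrable.comp_fst (f := fun η : ℝ => η) D.subgaussian_rewardNoise.integrable _
      have k2 : Integrable (fun z : ℝ × Vec n => (1 - ρ)⁻¹ * (inner ℝ D.ω z.2 : ℝ))
        (D.rewardNoise.prod D.stateNoise) :=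
        ((D.integrable_stateNoise_inner D.ω).comp_snd _).const_mul _
      have m1 := measurable_totalReward (n := n) (U := U) (t := t + 1)
      have m2 := D.measurable_inputSum (t := t + 1)
      obtain ⟨j1, j2⟩ := integral_law_succ D π
        (F := fun p => totalReward p + (1 - ρ)⁻¹ * (inner ℝ D.ω p.2 - D.inputSum p))
        (G := fun w => totalReward w.1 + (1 - ρ)⁻¹ * (inner ℝ D.ω w.1.2 - D.inputSum w.1))
        (N := fun z => z.1 + (1 - ρ)⁻¹ * inner ℝ D.ω z.2) (by fun_prop)
        (fun q => by
          rw [totalReward_step, inputSum_step]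
          simp only [step, hA, inner_add_right, inner_smul_right, hθ, inner_zero_left]
          field_simp
          ring) i1 (k1.add k2)
      refine ⟨j1, ?_⟩
      rw [j2, i2, ih.2, integral_add k1 k2, integral_const_mul, integral_fun_snd,
        D.integral_stateNoise_inner, integral_fun_fst (f := fun η : ℝ => η), D.mean_rewardNoise]
      simp
  have hs := (integrable_inner_state π hA hB hx hρ hρ1 hb t).1
  have hi := integrable_inputSum (D := D) π hB t
  have hc : Integrable (fun p : History n d U t × Vec n =>
      (1 - ρ)⁻¹ * (inner ℝ D.ω p.2 - D.inputSum p)) (D.law π t) := (hs.sub hi).const_mul _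
  have ht : Integrable (totalReward : History n d U t × Vec n → ℝ) (D.law π t) := by
    refine (key.1.sub hc).congr (Eventually.of_forall fun p => ?_)
    simp
  refine ⟨ht, ?_⟩
  have h2 := key.2
  rw [integral_add ht hc, integral_const_mul, integral_sub hs hi] at h2
  rw [div_eq_inv_mul]
  linarith

end Scalar
end DLB

namespace DLB

section Scalar

variable {n d : ℕ} {U : Set (Vec d)} {D : DLB n d U} {ρ b : ℝ}

theorem inputSum_le (hB : ∀ u ∈ U, |inner ℝ D.ω (matCLM D.B u)| ≤ b) {t : ℕ}
    (p : History n d U t × Vec n) : D.inputSum p ≤ t * b := by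
  refine (Finset.sum_le_sum fun s _ => (le_abs_self _).trans (hB _ (p.1 s).2.1.2)).trans_eq ?_
  simp

theorem integral_inputSum_const (hB : ∀ u ∈ U, |inner ℝ D.ω (matCLM D.B u)| ≤ b) (u : U) (t : ℕ) :
    ∫ p, D.inputSum p ∂D.law (Policy.const u) t = t * inner ℝ D.ω (matCLM D.B (u : Vec d)) := by
  induction t with
  | zero => simp [inputSum]
  | succ t ih =>
    obtain ⟨i1, i2⟩ := integrable_comp_fst_compProd D (Policy.const u)
      (integrable_inputSum (D := D) (Policy.const u) hB t)
    have i3 : Integrable (fun w : (History n d U t × Vec n) × U =>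
        (inner ℝ D.ω (matCLM D.B (w.2 : Vec d)) : ℝ))
        ((D.law (Policy.const u) t).compProd ((Policy.const u).act t)) :=
      Integrable.of_bound (by fun_prop) b (Eventually.of_forall fun w => hB _ w.2.2)
    have hF := D.measurable_inputSum (t := t + 1)
    obtain ⟨-, j2⟩ := integral_law_succ D (Policy.const u) (F := D.inputSum)
      (G := fun w => D.inputSum w.1 + inner ℝ D.ω (matCLM D.B (w.2 : Vec d))) (N := fun _ => 0)
      hF (fun q => by rw [inputSum_step, add_zero]) (i1.add i3) (integrable_zero _ _ _)
    rw [j2, integral_add i1 i3, i2, ih]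
    have h3 : ∫ w : (History n d U t × Vec n) × U, (inner ℝ D.ω (matCLM D.B (w.2 : Vec d)) : ℝ)
        ∂((D.law (Policy.const u) t).compProd ((Policy.const u).act t)) =
        inner ℝ D.ω (matCLM D.B (u : Vec d)) := by
      have : (Policy.const u : Policy n d U).act t = Kernel.const _ (Measure.dirac u) := rfl
      rw [this, Measure.compProd_const,
        integral_fun_snd (f := fun v : U => (inner ℝ D.ω (matCLM D.B (v : Vec d)) : ℝ)),
        integral_dirac' _ _ (Measurable.stronglyMeasurable (by fun_prop))]
      simp
    rw [h3]
    push_cast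
    simp
    ring

theorem J_le (hA : ∀ x, matCLM D.A x = ρ • x) (hθ : D.θ = 0)
    (hB : ∀ u ∈ U, |inner ℝ D.ω (matCLM D.B u)| ≤ b) (hx : D.x₁ = 0) (hρ : 0 ≤ ρ) (hρ1 : ρ < 1)
    (hb : 0 ≤ b) (π : Policy n d U) : D.J π ≤ ((b / (1 - ρ) : ℝ) : EReal) := by
  have h1ρ : 0 < 1 - ρ := by linarith
  have hlim : Tendsto (fun H : ℕ => (((b + b / (1 - ρ) * (1 / (H : ℝ))) / (1 - ρ) : ℝ) : EReal))
      atTop (𝓝 ((b / (1 - ρ) : ℝ) : EReal)) := by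
    refine (continuous_coe_real_ereal.tendsto _).comp ?_
    have := ((tendsto_one_div_atTop_nhds_zero_nat (𝕜 := ℝ)).const_mul (b / (1 - ρ))).const_add b
    simpa using this.div_const (1 - ρ)
  rw [← hlim.liminf_eq]
  refine liminf_le_liminf ?_
  filter_upwards [eventually_gt_atTop 0] with H hH
  have hH' : (0 : ℝ) < H := by exact_mod_cast hH
  refine EReal.coe_le_coe_iff.2 ?_
  rw [integral_const_mul, (integral_totalReward π hA hθ hB hx hρ hρ1 hb H).2, mul_div_assoc']
  gcongr
  have h1 : ∫ p, D.inputSum p ∂D.law π H ≤ H * b := by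
    have := integral_mono (integrable_inputSum π hB H) (integrable_const (H * b))
      (fun p => inputSum_le hB p)
    simpa using this
  have h2 := (abs_le.1 (integrable_inner_state π hA hB hx hρ hρ1 hb H).2).1
  have : b + b / (1 - ρ) * (1 / (H : ℝ)) = 1 / H * (H * b + b / (1 - ρ)) := by field_simp
  rw [this]
  gcongr
  linarith

/-- The bounded term `E⟨ω, x⟩` disappears in the average over the rounds. -/
theorem J_const (hA : ∀ x, matCLM D.A x = ρ • x) (hθ : D.θ = 0)
    (hB : ∀ u ∈ U, |inner ℝ D.ω (matCLM D.B u)| ≤ b) (hx : D.x₁ = 0) (hρ : 0 ≤ ρ) (hρ1 : ρ < 1)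
    (hb : 0 ≤ b) (u : U) : D.J (Policy.const u) =
      ((inner ℝ D.ω (matCLM D.B (u : Vec d)) / (1 - ρ) : ℝ) : EReal) := by
  refine Tendsto.liminf_eq ((continuous_coe_real_ereal.tendsto _).comp ?_)
  have hm : Tendsto (fun H : ℕ => (1 / (H : ℝ)) *
      ∫ p, inner ℝ D.ω p.2 ∂D.law (Policy.const u) H) atTop (𝓝 0) := by
    have h0 := (tendsto_one_div_atTop_nhds_zero_nat (𝕜 := ℝ)).mul_const (b / (1 - ρ))
    rw [zero_mul] at h0
    refine squeeze_zero_norm (fun H => ?_) h0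
    rw [norm_mul, Real.norm_of_nonneg (by positivity), Real.norm_eq_abs]
    gcongr
    exact (integrable_inner_state _ hA hB hx hρ hρ1 hb H).2
  have hlim := (hm.const_sub (inner ℝ D.ω (matCLM D.B (u : Vec d)))).div_const (1 - ρ)
  rw [sub_zero] at hlim
  refine hlim.congr' ?_
  filter_upwards [eventually_gt_atTop 0] with H hH
  have hH' : (H : ℝ) ≠ 0 := by positivity
  rw [integral_const_mul, (integral_totalReward _ hA hθ hB hx hρ hρ1 hb H).2,
    integral_inputSum_const hB u H]
  field_simp

/-- Up to the contribution of the last state, the regret is the sum of the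
suboptimality gaps of the actions played. -/
theorem expectedRegretAtLeast (hA : ∀ x, matCLM D.A x = ρ • x) (hθ : D.θ = 0)
    (hB : ∀ u ∈ U, |inner ℝ D.ω (matCLM D.B u)| ≤ b) (hx : D.x₁ = 0) (hρ : 0 ≤ ρ) (hρ1 : ρ < 1)
    (hb : 0 ≤ b) (π : Policy n d U) (u : U) (hu : inner ℝ D.ω (matCLM D.B (u : Vec d)) = b)
    (T : ℕ) {r : ℝ}
    (hr : r ≤ (T * b - ∫ p, D.inputSum p ∂D.law π T - b / (1 - ρ)) / (1 - ρ)) :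
    D.ExpectedRegretAtLeast π T r := by
  have h1ρ : 0 < 1 - ρ := by linarith
  have hJ := J_const hA hθ hB hx hρ hρ1 hb u
  rw [hu] at hJ
  obtain ⟨i1, i2⟩ := integral_totalReward π hA hθ hB hx hρ hρ1 hb T
  refine ⟨u, b / (1 - ρ), fun π' => ?_, hJ, (integrable_const _).sub i1, hr.trans ?_⟩
  · rw [hJ]
    exact J_le hA hθ hB hx hρ hρ1 hb π'
  · have h2 := (abs_le.1 (integrable_inner_state π hA hB hx hρ hρ1 hb T).2).1
    simp only [regret]
    rw [integral_sub (integrable_const _) i1, i2, integral_const, probReal_univ, one_smul,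
      mul_div_assoc', ← sub_div]
    exact div_le_div_of_nonneg_right (by linarith) h1ρ.le

end Scalar

end DLB

/-! ### Diagonal and scalar matrices -/

theorem matCLM_diagonal_apply {n : ℕ} (a : Fin n → ℝ) (x : Vec n) (i : Fin n) :
    matCLM (Matrix.diagonal a) x i = a i * x i := by
  simp [matCLM, Matrix.toLpLin_apply, Matrix.mulVec_diagonal]

theorem matCLM_diagonal_const {n : ℕ} (r : ℝ) (x : Vec n) :
    matCLM (Matrix.diagonal fun _ : Fin n => r) x = r • x := by
  ext i
  simp [matCLM_diagonal_apply]

theorem norm_matCLM_diagonal_le {n : ℕ} {a : Fin n → ℝ} {r : ℝ} (hr : 0 ≤ r)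
    (ha : ∀ i, |a i| ≤ r) : ‖matCLM (Matrix.diagonal a)‖ ≤ r := by
  refine ContinuousLinearMap.opNorm_le_bound _ hr fun x => ?_
  rw [← abs_of_nonneg hr, ← Real.norm_eq_abs, ← norm_smul]
  rw [EuclideanSpace.norm_eq, EuclideanSpace.norm_eq]
  refine Real.sqrt_le_sqrt (Finset.sum_le_sum fun i _ => ?_)
  rw [matCLM_diagonal_apply, PiLp.smul_apply, norm_mul, norm_smul, Real.norm_of_nonneg hr]
  gcongr
  exact ha i

theorem specRad_diagonal_const {n : ℕ} (hn : 1 ≤ n) {r : ℝ} (hr : 0 ≤ r) :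
    specRad (Matrix.diagonal fun _ : Fin n => r) = ENNReal.ofReal r := by
  have : Nonempty (Fin n) := ⟨⟨0, hn⟩⟩
  have h : (Matrix.diagonal fun _ : Fin n => r).map (algebraMap ℝ ℂ) =
      algebraMap ℂ (Matrix (Fin n) (Fin n) ℂ) (r : ℂ) := by
    rw [Matrix.diagonal_map (map_zero _), Matrix.algebraMap_eq_diagonal]
    rfl
  rw [specRad, h, spectralRadius, spectrum.scalar_eq]
  simp only [Set.mem_singleton_iff, iSup_iSup_eq_left]
  rw [← enorm_eq_nnnorm, ← ofReal_norm, Complex.norm_real, Real.norm_of_nonneg hr]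

theorem Phi_diagonal_const_le_one {n : ℕ} (hn : 1 ≤ n) {r : ℝ} (hr : 0 ≤ r) :
    Phi (Matrix.diagonal fun _ : Fin n => r) ≤ 1 := by
  refine iSup_le fun τ => ENNReal.div_le_of_le_mul ?_
  rw [specRad_diagonal_const hn hr, one_mul, ← ENNReal.ofReal_pow hr, Matrix.diagonal_pow,
    ← ofReal_norm]
  exact ENNReal.ofReal_le_ofReal (norm_matCLM_diagonal_le (pow_nonneg hr τ) fun i =>
    (abs_of_nonneg (pow_nonneg hr τ)).le)

/-! ### Noise models -/

/-- A centered `1`-subgaussian noise law on `ℝᵈ` with a set containing `0` that is left invariant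
by the dynamics `x ↦ ρ x + v + ε` for all inputs `v` with coordinates in `[-δ, δ]`. -/
structure NoiseModel (d : ℕ) (ρ δ : ℝ) where
  /-- the law of the noise -/
  law : Measure (Vec d)
  /-- the invariant set -/
  stateSpace : Set (Vec d)
  prob : IsProbabilityMeasure law
  mean : ∫ ε, ε ∂law = 0
  subgaussian : ∀ ζ : Vec d, HasSubgaussianMGF (fun ε : Vec d => inner ℝ ζ ε) (‖ζ‖₊ ^ 2) law
  zero_mem : 0 ∈ stateSpace
  step_mem : ∀ x ∈ stateSpace, ∀ v : Vec d, (∀ i, |v i| ≤ δ) →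
    ∀ᵐ ε ∂law, ρ • x + v + ε ∈ stateSpace

/-- The standard Gaussian noise, with all of `ℝᵈ` as the state space. -/
noncomputable def NoiseModel.gaussian (d : ℕ) (ρ δ : ℝ) : NoiseModel d ρ δ where
  law := stdGaussian (Vec d)
  stateSpace := Set.univ
  prob := inferInstance
  mean := integral_id_stdGaussian
  subgaussian := hasSubgaussianMGF_inner_stdGaussian
  zero_mem := Set.mem_univ _
  step_mem _ _ _ _ := Eventually.of_forall fun _ => Set.mem_univ _

/-- The Gaussian noise cut off at norm `L`, with a ball as the state space. -/
noncomputable def NoiseModel.ofCutoff (d : ℕ) {ρ δ L : ℝ} (hρ : 0 ≤ ρ) (hρ1 : ρ < 1) (hδ : 0 ≤ δ)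
    (hL : 0 ≤ L) : NoiseModel d ρ δ where
  law := cutoffGaussian d L
  stateSpace := Metric.closedBall 0 ((√d * δ + L) / (1 - ρ))
  prob := inferInstance
  mean := integral_id_cutoffGaussian d L
  subgaussian := hasSubgaussianMGF_inner_cutoffGaussian L
  zero_mem := Metric.mem_closedBall_self (div_nonneg (by positivity) (by linarith))
  step_mem x hx v hv := by
    have h1ρ : 1 - ρ ≠ 0 := by linarith
    rw [cutoffGaussian, ae_map_iff (measurable_cutoff L).aemeasurable
      (Metric.isClosed_closedBall.measurableSet.preimage (by fun_prop))]
    refine Eventually.of_forall fun z => ?_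
    rw [mem_closedBall_zero_iff] at hx ⊢
    have hv' : ‖v‖ ≤ √d * δ := by
      rw [EuclideanSpace.norm_eq, ← Real.sqrt_sq hδ, ← Real.sqrt_mul (Nat.cast_nonneg d)]
      refine Real.sqrt_le_sqrt ((Finset.sum_le_sum fun i _ =>
        pow_le_pow_left₀ (norm_nonneg _) (hv i) 2).trans_eq ?_)
      simp
    calc ‖ρ • x + v + cutoff L z‖ ≤ ‖ρ • x‖ + ‖v‖ + ‖cutoff L z‖ := norm_add₃_le
      _ ≤ ρ * ((√d * δ + L) / (1 - ρ)) + √d * δ + L := by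
        rw [norm_smul, Real.norm_of_nonneg hρ]
        gcongr
        exact norm_cutoff_le hL z
      _ = _ := by field_simp; ring

/-! ### The hard instances -/

theorem abs_units_int_cast (a : ℤˣ) : |((a : ℤ) : ℝ)| = 1 := by
  rcases Int.units_eq_one_or a with h | h <;> simp [h]

theorem abs_apply_of_mem_hypercube {d : ℕ} {u : Vec d} (hu : u ∈ hypercube d) (i : Fin d) :
    |u i| = 1 := by
  rcases hu i with h | h <;> simp [h]

/-- The action with a given sign pattern. -/
noncomputable def signAction {d : ℕ} (s : Fin d → ℤˣ) : hypercube d :=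
  ⟨WithLp.toLp 2 fun i => ((s i : ℤ) : ℝ), fun i => by
    rcases Int.units_eq_one_or (s i) with h | h <;> simp [h]⟩

namespace DLB

variable {d : ℕ} {ρ δ : ℝ}

/-- The hard instance with sign pattern `s`: the state follows `x ↦ ρ x + δ (s ⊙ u) + ε`, with
`⊙` the coordinatewise product, and the reward is the sum of the coordinates of the state plus
standard Gaussian noise. The sign `s i` is the optimal choice for the `i`-th coordinate of the
action. -/
noncomputable def signed (N : NoiseModel d ρ δ) (hδ : 0 ≤ δ) (s : Fin d → ℤˣ) :
    DLB d d (hypercube d) where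
  stateSpace := N.stateSpace
  x₁ := 0
  A := Matrix.diagonal fun _ => ρ
  B := Matrix.diagonal fun i => δ * (s i : ℤ)
  ω := WithLp.toLp 2 fun _ => 1
  θ := 0
  σ := 1
  rewardNoise := gaussianReal 0 1
  stateNoise := N.law
  prob_rewardNoise := inferInstance
  prob_stateNoise := N.prob
  mean_rewardNoise := integral_id_gaussianReal
  mean_stateNoise := N.mean
  subgaussian_rewardNoise :=
    ⟨integrable_exp_mul_gaussianReal, fun t => by rw [mgf_fun_id_gaussianReal]; simp⟩
  subgaussian_stateNoise ζ := by simpa using N.subgaussian ζ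
  init_mem := N.zero_mem
  step_mem x hx u hu := by
    simp only [matCLM_diagonal_const]
    refine N.step_mem x hx _ fun i => ?_
    rw [matCLM_diagonal_apply, abs_mul, abs_mul, abs_units_int_cast,
      abs_apply_of_mem_hypercube hu, abs_of_nonneg hδ, mul_one, mul_one]

variable (N : NoiseModel d ρ δ) (hδ : 0 ≤ δ) (s : Fin d → ℤˣ)

theorem matCLM_signed_A (x : Vec d) : matCLM (signed N hδ s).A x = ρ • x :=
  matCLM_diagonal_const ρ x

theorem inner_signed_input (u : Vec d) :
    inner ℝ (signed N hδ s).ω (matCLM (signed N hδ s).B u) =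
      ∑ i, δ * (s i : ℤ) * u i := by
  simp [signed, PiLp.inner_apply, matCLM_diagonal_apply]

theorem abs_inner_signed_input_le (u : Vec d) (hu : u ∈ hypercube d) :
    |inner ℝ (signed N hδ s).ω (matCLM (signed N hδ s).B u)| ≤ d * δ := by
  rw [inner_signed_input]
  refine (Finset.abs_sum_le_sum_abs _ _).trans_eq ?_
  simp [abs_mul, abs_units_int_cast, abs_apply_of_mem_hypercube hu, abs_of_nonneg hδ]

theorem inner_signed_signAction :
    inner ℝ (signed N hδ s).ω (matCLM (signed N hδ s).B (signAction s : Vec d)) = d * δ := by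
  have h : ∀ i, ((s i : ℤ) : ℝ) * (s i : ℤ) = 1 := fun i => by
    rcases Int.units_eq_one_or (s i) with h | h <;> simp [h]
  rw [inner_signed_input]
  simp [signAction, mul_assoc, h]

theorem isHardInstance_signed (hd : 1 ≤ d) (hρ : 0 ≤ ρ) (hρ1 : ρ < 1) (hdδ : d * δ ≤ 1 - ρ) :
    (signed N hδ s).IsHardInstance ρ := by
  have h1ρ : 0 < 1 - ρ := by linarith
  have hd' : (1 : ℝ) ≤ d := by exact_mod_cast hd
  have hr : specRad (signed N hδ s).A = ENNReal.ofReal ρ := specRad_diagonal_const hd hρ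
  refine ⟨⟨?_, (Phi_diagonal_const_le_one hd hρ).trans_lt ENNReal.one_lt_top⟩, hr,
    ⟨0, fun _ => ρ, le_rfl, hρ, fun _ => Or.inl rfl, rfl⟩, ⟨?_, ?_, ?_, ?_, ?_⟩, rfl, rfl⟩
  · rw [hr]
    exact ENNReal.ofReal_lt_one.2 hρ1
  · simp [signed]
  · simp [signed, EuclideanSpace.norm_eq]
  · refine norm_matCLM_diagonal_le h1ρ.le fun i => ?_
    rw [abs_mul, abs_units_int_cast, abs_of_nonneg hδ, mul_one]
    nlinarith
  · intro u hu
    rw [EuclideanSpace.norm_eq]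
    refine (congrArg Real.sqrt ?_).le
    simp [-sq_abs, abs_apply_of_mem_hypercube hu]
  · intro u
    rw [J_const (D := signed N hδ s) (matCLM_signed_A N hδ s) rfl
      (abs_inner_signed_input_le N hδ s) rfl hρ hρ1 (by positivity) u]
    have h := abs_le.1 (abs_inner_signed_input_le N hδ s u u.2)
    constructor
    · rw [← EReal.coe_one, ← EReal.coe_neg, EReal.coe_le_coe_iff, le_div_iff₀ h1ρ]
      linarith
    · rw [← EReal.coe_one, EReal.coe_le_coe_iff, div_le_one h1ρ]
      linarith

/-- The sum of the `i`-th coordinates of the actions played. -/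
noncomputable def actionSum {n : ℕ} (i : Fin d) {t : ℕ} (p : History n d (hypercube d) t × Vec n) :
    ℝ :=
  ∑ r : Fin t, ((p.1 r).2.1 : Vec d) i

theorem measurable_actionSum {n : ℕ} (i : Fin d) {t : ℕ} :
    Measurable (actionSum i : History n d (hypercube d) t × Vec n → ℝ) := by
  unfold actionSum; fun_prop

theorem abs_actionSum_le {n : ℕ} (i : Fin d) {t : ℕ} (p : History n d (hypercube d) t × Vec n) :
    |actionSum i p| ≤ t := by
  refine (Finset.abs_sum_le_sum_abs _ _).trans_eq ?_
  simp [abs_apply_of_mem_hypercube (p.1 _).2.1.2]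

theorem integrable_actionSum {n : ℕ} (i : Fin d) {t : ℕ}
    (μ : Measure (History n d (hypercube d) t × Vec n)) [IsFiniteMeasure μ] :
    Integrable (actionSum i) μ :=
  Integrable.of_bound (measurable_actionSum i).aestronglyMeasurable t
    (Eventually.of_forall (abs_actionSum_le i))

theorem integral_inputSum_signed (π : Policy d d (hypercube d)) (t : ℕ) :
    ∫ p, (signed N hδ s).inputSum p ∂(signed N hδ s).law π t =
      ∑ i, δ * ((s i : ℤ) * ∫ p, actionSum i p ∂(signed N hδ s).law π t) := by
  have h : ∀ p : History d d (hypercube d) t × Vec d,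
      (signed N hδ s).inputSum p = ∑ i, δ * ((s i : ℤ) * actionSum i p) := by
    intro p
    simp only [inputSum, inner_signed_input, actionSum, Finset.mul_sum, mul_assoc]
    rw [Finset.sum_comm]
  simp only [h]
  rw [integral_finsetSum _ fun i _ => ((integrable_actionSum i _).const_mul _).const_mul _]
  simp only [integral_const_mul]

/-- One round of two hard instances whose sign patterns differ in one coordinate: the next states
differ by a shift of length `2δ` along that coordinate. -/
theorem sq_lintegral_signed_step_le {k e : ℝ≥0∞} (hN : ShiftRegular N.law (2 * δ) k e)
    {s s' : Fin d → ℤˣ} (i : Fin d) (hs : ∀ j, j ≠ i → s' j = s j) (t : ℕ)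
    (w : (History d d (hypercube d) t × Vec d) × hypercube d)
    (f : History d d (hypercube d) (t + 1) × Vec d → ℝ≥0∞) (hf : Measurable f)
    (hf1 : ∀ p, f p ≤ 1) :
    (∫⁻ z, f ((signed N hδ s').step t (w, z))
        ∂((signed N hδ s').rewardNoise.prod (signed N hδ s').stateNoise)) ^ 2 ≤
      k * ∫⁻ z, f ((signed N hδ s).step t (w, z)) ^ 2
        ∂((signed N hδ s).rewardNoise.prod (signed N hδ s).stateNoise) + e := by
  have hm := hf.comp (((signed N hδ s).measurable_step t).comp (measurable_prodMk_left (x := w)))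
  have hm' := hf.comp
    (((signed N hδ s').measurable_step t).comp (measurable_prodMk_left (x := w)))
  simp only [Function.comp_def] at hm hm'
  set c : ℝ := δ * ((s' i : ℤ) - (s i : ℤ)) * (w.2 : Vec d) i with hc
  have hcr : |c| ≤ 2 * δ := by
    rw [hc, abs_mul, abs_apply_of_mem_hypercube w.2.2, abs_mul, abs_of_nonneg hδ, mul_one, mul_comm]
    gcongr
    refine (abs_sub _ _).trans_eq ?_
    rw [abs_units_int_cast, abs_units_int_cast]; norm_num
  have hB : matCLM (signed N hδ s').B (w.2 : Vec d) =
      matCLM (signed N hδ s).B (w.2 : Vec d) + EuclideanSpace.single i c := by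
    ext j
    rw [PiLp.add_apply]
    simp only [signed, matCLM_diagonal_apply]
    by_cases hj : j = i
    · subst hj
      simp [hc]; ring
    · simp [hj, hs j hj]
  have hshift : ∀ η ε, (signed N hδ s').step t (w, (η, ε)) =
      (signed N hδ s).step t (w, (η, EuclideanSpace.single i c + ε)) := by
    intro η ε
    simp only [step, hB, add_assoc]
    rfl
  have hstate : (signed N hδ s').stateNoise = (signed N hδ s).stateNoise := rfl
  have hreward : (signed N hδ s').rewardNoise = (signed N hδ s).rewardNoise := rfl
  rw [lintegral_prod _ hm'.aemeasurable, lintegral_prod _ (hm.pow_const 2).aemeasurable,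
    ← lintegral_const_mul _ (hm.pow_const 2).lintegral_prod_right', hstate, hreward]
  refine (sq_lintegral_le _ hm'.lintegral_prod_right').trans ?_
  calc _ ≤ ∫⁻ η, (k * (∫⁻ ε, f ((signed N hδ s).step t (w, (η, ε))) ^ 2
          ∂(signed N hδ s).stateNoise) + e) ∂(signed N hδ s).rewardNoise := by
        refine lintegral_mono fun η => ?_
        simp only [hshift]
        exact hN i c hcr (fun ε => f ((signed N hδ s).step t (w, (η, ε))))
          (hm.comp measurable_prodMk_left) fun _ => hf1 _
    _ = _ := by
        rw [lintegral_add_right _ measurable_const]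
        simp

/-- A policy cannot tell two sign patterns apart that differ in one coordinate. -/
theorem integral_actionSum_sub_le {k e : ℝ≥0∞} {T : ℕ} (hN : ShiftRegular N.law (2 * δ) k e)
    (hk : 1 ≤ k) (hkT : k ^ T ≤ 2) (he : T * k ^ T * e ≤ ENNReal.ofReal (1 / 4)) (hT : 0 < T)
    {s s' : Fin d → ℤˣ} (i : Fin d) (hs : ∀ j, j ≠ i → s' j = s j)
    (π : Policy d d (hypercube d)) :
    ∫ p, actionSum i p ∂(signed N hδ s').law π T - ∫ p, actionSum i p ∂(signed N hδ s).law π T ≤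
      3 / 2 * T := by
  have hT' : (0 : ℝ) < T := by exact_mod_cast hT
  -- the average action, rescaled to `[0, 1]`
  set g : History d d (hypercube d) T × Vec d → ℝ := fun p => (1 + actionSum i p / T) / 2 with hg
  have hgm : Measurable g := by
    have := measurable_actionSum (n := d) i (t := T)
    fun_prop
  have hg01 : ∀ p, 0 ≤ g p ∧ g p ≤ 1 := by
    intro p
    have h := abs_le.1 (abs_actionSum_le i p)
    have h1 : -1 ≤ actionSum i p / T := by rw [le_div_iff₀ hT']; linarith
    have h2 : actionSum i p / T ≤ 1 := by rw [div_le_iff₀ hT']; linarith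
    constructor <;> simp only [hg] <;> linarith
  have hgi : ∀ s, ∫ p, g p ∂(signed N hδ s).law π T =
      (1 + (∫ p, actionSum i p ∂(signed N hδ s).law π T) / T) / 2 := by
    intro s
    simp only [hg]
    rw [integral_div, integral_add (integrable_const _) ((integrable_actionSum i _).div_const _),
      integral_div]
    simp
  have hgint : ∀ s, Integrable g ((signed N hδ s).law π T) := fun s =>
    Integrable.of_bound hgm.aestronglyMeasurable 1 (Eventually.of_forall fun p => by
      rw [Real.norm_of_nonneg (hg01 p).1]; exact (hg01 p).2)
  have hof : ∀ s, ∫⁻ p, ENNReal.ofReal (g p) ∂(signed N hδ s).law π T =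
      ENNReal.ofReal (∫ p, g p ∂(signed N hδ s).law π T) := fun s =>
    (ofReal_integral_eq_lintegral_ofReal (hgint s)
      (Eventually.of_forall fun p => (hg01 p).1)).symm
  have hnn : ∀ s, 0 ≤ ∫ p, g p ∂(signed N hδ s).law π T := fun s =>
    integral_nonneg fun p => (hg01 p).1
  have key := sq_lintegral_law_le (signed N hδ s) (signed N hδ s') π rfl hk
    (fun t w f hf hf1 => sq_lintegral_signed_step_le N hδ hN i hs t w f hf hf1) T
    (fun p => ENNReal.ofReal (g p)) (by fun_prop) fun p => ENNReal.ofReal_le_one.2 (hg01 p).2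
  have hreal : (∫ p, g p ∂(signed N hδ s').law π T) ^ 2 ≤
      2 * ∫ p, g p ∂(signed N hδ s).law π T + 1 / 4 := by
    have hsq : ∀ p, ENNReal.ofReal (g p) ^ 2 ≤ ENNReal.ofReal (g p) := fun p =>
      pow_le_of_le_one zero_le (ENNReal.ofReal_le_one.2 (hg01 p).2) two_ne_zero
    have h2 := hnn s
    rw [← ENNReal.ofReal_le_ofReal_iff (by positivity), ENNReal.ofReal_pow (hnn s'),
      ENNReal.ofReal_add (by positivity) (by norm_num), ENNReal.ofReal_mul (by norm_num), ← hof,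
      ← hof, ENNReal.ofReal_ofNat]
    refine key.trans (add_le_add (mul_le_mul' hkT (lintegral_mono hsq)) he)
  rw [hgi, hgi] at hreal
  set a' := ∫ p, actionSum i p ∂(signed N hδ s').law π T
  set a := ∫ p, actionSum i p ∂(signed N hδ s).law π T
  -- `x'² ≤ 2 x + 1/4` gives `x' - x ≤ 5/8` for the rescaled averages
  have h3 : a' / T - a / T ≤ 3 / 2 := by nlinarith [sq_nonneg (a' / T - 1)]
  rw [← sub_div, div_le_iff₀ hT'] at h3
  exact h3

end DLB

/-! ### Averaging over the sign patterns -/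

/-- If flipping the `i`-th sign changes `M s i` by at most `3/2 T`, then for some `s` the
coordinates of `M s` are on average far from the values `s i * T`. -/
theorem exists_sign_sum_ge {d : ℕ} {T : ℝ} (M : (Fin d → ℤˣ) → Fin d → ℝ)
    (hM : ∀ s s' : Fin d → ℤˣ, ∀ i, (∀ j, j ≠ i → s' j = s j) → M s' i - M s i ≤ 3 / 2 * T) :
    ∃ s : Fin d → ℤˣ, d * (T / 4) ≤ ∑ i, (T - (s i : ℤ) * M s i) := by
  have hcoord : ∀ i, ∑ _s : Fin d → ℤˣ, T / 4 ≤ ∑ s : Fin d → ℤˣ, (T - (s i : ℤ) * M s i) := by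
    intro i
    set flipSign : (Fin d → ℤˣ) ≃ (Fin d → ℤˣ) := Equiv.mulRight (Pi.mulSingle i (-1)) with hflip
    have hfi : ∀ s, (((flipSign s) i : ℤ) : ℝ) = -(s i : ℤ) := fun s => by simp [hflip]
    have hfj : ∀ s j, j ≠ i → flipSign s j = s j := fun s j hj => by simp [hflip, hj]
    have h1 := Equiv.sum_comp flipSign fun s : Fin d → ℤˣ => T - (s i : ℤ) * M s i
    have h2 : ∑ _s : Fin d → ℤˣ, T / 2 ≤ ∑ s : Fin d → ℤˣ,
        ((T - (s i : ℤ) * M s i) + (T - ((flipSign s) i : ℤ) * M (flipSign s) i)) := by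
      refine Finset.sum_le_sum fun s _ => ?_
      rw [hfi]
      have h3 := hM s (flipSign s) i (hfj s)
      have h4 := hM (flipSign s) s i fun j hj => (hfj s j hj).symm
      rcases Int.units_eq_one_or (s i) with h | h <;> simp only [h] <;> push_cast <;> linarith
    rw [Finset.sum_add_distrib, h1] at h2
    have h5 : ∑ _s : Fin d → ℤˣ, T / 2 = 2 * ∑ _s : Fin d → ℤˣ, T / 4 := by
      rw [Finset.mul_sum]
      exact Finset.sum_congr rfl fun _ _ => by ring
    linarith
  have hsum : ∑ _s : Fin d → ℤˣ, d * (T / 4) ≤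
      ∑ s : Fin d → ℤˣ, ∑ i, (T - (s i : ℤ) * M s i) := by
    rw [Finset.sum_comm]
    refine le_trans (le_of_eq ?_) (Finset.sum_le_sum fun i _ => hcoord i)
    simp
    ring
  obtain ⟨s, -, hs⟩ := Finset.exists_le_of_sum_le Finset.univ_nonempty hsum
  exact ⟨s, hs⟩

/-- For every noise model that hides shifts of length `2δ`, some sign pattern is hard. -/
theorem DLB.exists_signed_regret {d : ℕ} {ρ δ : ℝ} (N : NoiseModel d ρ δ) (hδ : 0 ≤ δ)
    {k e : ℝ≥0∞} {T : ℕ} (hN : ShiftRegular N.law (2 * δ) k e)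
    (hk : 1 ≤ k) (hkT : k ^ T ≤ 2) (he : T * k ^ T * e ≤ ENNReal.ofReal (1 / 4))
    (hρ : 0 ≤ ρ) (hρ1 : ρ < 1) (hT : 8 / (1 - ρ) ≤ T) (π : Policy d d (hypercube d)) :
    ∃ s : Fin d → ℤˣ,
      (signed N hδ s).ExpectedRegretAtLeast π T (d * (δ * T / (1 - ρ)) / 8) := by
  have h1ρ : 0 < 1 - ρ := by linarith
  have hT0 : 0 < T := by
    have : (0 : ℝ) < T := lt_of_lt_of_le (by positivity) hT
    exact_mod_cast this
  obtain ⟨s, hs⟩ := exists_sign_sum_ge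
    (fun s i => ∫ p, actionSum i p ∂(signed N hδ s).law π T)
    fun s s' i hss => integral_actionSum_sub_le N hδ hN hk hkT he hT0 i hss π
  refine ⟨s, expectedRegretAtLeast (D := signed N hδ s) (matCLM_signed_A N hδ s) rfl
    (abs_inner_signed_input_le N hδ s) rfl hρ hρ1 (by positivity) π (signAction s)
    (inner_signed_signAction N hδ s) T ?_⟩
  have hin : T * (d * δ) - ∫ p, (signed N hδ s).inputSum p ∂(signed N hδ s).law π T =
      δ * ∑ i, ((T : ℝ) - (s i : ℤ) * ∫ p, actionSum i p ∂(signed N hδ s).law π T) := by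
    rw [integral_inputSum_signed, ← Finset.mul_sum, Finset.sum_sub_distrib]
    simp
    ring
  rw [hin, le_div_iff₀ h1ρ]
  have h2 := mul_le_mul_of_nonneg_left hs hδ
  have h3 : d * δ / (1 - ρ) ≤ d * δ * (T / 8) := by
    rw [div_eq_mul_inv]
    gcongr
    rw [div_le_iff₀ h1ρ] at hT
    rw [inv_le_iff_one_le_mul₀ h1ρ]
    linarith
  have h4 : d * (δ * T / (1 - ρ)) / 8 * (1 - ρ) = d * δ * T / 8 := by field_simp
  rw [h4]
  linarith

theorem theorem2 :
    ∃ c C : ℝ, 0 < c ∧ 0 < C ∧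
      ∀ (d : ℕ) (ρ : ℝ) (T : ℕ), 1 ≤ d → 0 ≤ ρ → ρ < 1 → C * ((d : ℝ) ^ 2 / (1 - ρ)) ≤ (T : ℝ) →
        ∀ π : Policy d d (hypercube d),
          -- an instance with Gaussian noise (hence unbounded states)
          (∃ D : DLB d d (hypercube d), D.IsHardInstance ρ ∧ D.StandardGaussianNoise ∧
            D.ExpectedRegretAtLeast π T (c * (d * √(T : ℝ) / √(1 - ρ)))) ∧
          -- an instance that also has bounded states
          (∃ D : DLB d d (hypercube d), D.IsHardInstance ρ ∧ (∃ X : ℝ, D.StateBound X) ∧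
            D.ExpectedRegretAtLeast π T (c * (d * √(T : ℝ) / √(1 - ρ)))) := by
  refine ⟨1 / 32, 8, by norm_num, by norm_num, fun d ρ T hd hρ hρ1 hCT π => ?_⟩
  have h1ρ : 0 < 1 - ρ := by linarith
  have hd' : (1 : ℝ) ≤ d := by exact_mod_cast hd
  have hT8 : 8 / (1 - ρ) ≤ T := by
    refine le_trans ?_ hCT
    rw [mul_div_assoc']
    gcongr
    nlinarith
  have hT0 : (0 : ℝ) < T := lt_of_lt_of_le (by positivity) hT8
  -- The shift per round is so small that `T` rounds carry only a constant amount of information.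
  set δ : ℝ := √(1 - ρ) / (4 * √T) with hδdef
  have hδ : 0 ≤ δ := by positivity
  have hδsq : δ ^ 2 = (1 - ρ) / (16 * T) := by
    rw [hδdef, div_pow, mul_pow, Real.sq_sqrt h1ρ.le, Real.sq_sqrt hT0.le]
    norm_num
  have hdδ : d * δ ≤ 1 - ρ := by
    refine abs_le_of_sq_le_sq' ?_ h1ρ.le |>.2
    rw [mul_pow, hδsq]
    rw [mul_div_assoc', div_le_iff₀ h1ρ] at hCT
    rw [mul_div_assoc', div_le_iff₀ (by positivity)]
    nlinarith
  set k : ℝ≥0∞ := ENNReal.ofReal (Real.exp ((2 * δ) ^ 2)) with hkdef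
  have hk : 1 ≤ k := ENNReal.one_le_ofReal.2 (Real.one_le_exp (by positivity))
  have hkT : k ^ T ≤ 2 := by
    rw [hkdef, ← ENNReal.ofReal_pow (Real.exp_nonneg _), ← Real.exp_nat_mul,
      ← ENNReal.ofReal_ofNat]
    refine ENNReal.ofReal_le_ofReal ?_
    have h1 : T * (2 * δ) ^ 2 ≤ 1 / 2 := by
      rw [mul_pow, hδsq]
      field_simp
      linarith
    have h2 := Real.exp_le_exp.2 h1
    have h3 : Real.exp (1 / 2) ^ 2 = Real.exp 1 := by rw [← Real.exp_nat_mul]; norm_num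
    nlinarith [Real.exp_one_lt_d9, Real.exp_pos (1 / 2)]
  have hr : d * (δ * T / (1 - ρ)) / 8 = 1 / 32 * (d * √(T : ℝ) / √(1 - ρ)) := by
    have h1 : δ * T / (1 - ρ) = √(T : ℝ) / (4 * √(1 - ρ)) := by
      have hsT : √(T : ℝ) ≠ 0 := by positivity
      have hsρ : √(1 - ρ) ≠ 0 := by positivity
      rw [hδdef]
      nth_rewrite 2 [← Real.sq_sqrt hT0.le]
      nth_rewrite 2 [← Real.sq_sqrt h1ρ.le]
      field_simp
    rw [h1]
    ring
  rw [← hr]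
  constructor
  · obtain ⟨s, hs⟩ := DLB.exists_signed_regret (NoiseModel.gaussian d ρ δ) hδ
      (shiftRegular_stdGaussian (2 * δ)) hk hkT (by simp) hρ hρ1 hT8 π
    exact ⟨_, DLB.isHardInstance_signed _ hδ s hd hρ hρ1 hdδ, ⟨rfl, rfl⟩, hs⟩
  · have hk3 : T * k ^ T * (k + 3) ≠ ⊤ := by finiteness
    have hq : 0 < ENNReal.ofReal (1 / 4) / (T * k ^ T * (k + 3)) :=
      ENNReal.div_pos (by simp) hk3
    obtain ⟨L, hL, hLq⟩ := exists_stdGaussian_compl_closedBall_le d hq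
    have he : T * k ^ T * ((k + 3) * stdGaussian (Vec d) (Metric.closedBall 0 L)ᶜ) ≤
        ENNReal.ofReal (1 / 4) := by
      rw [← mul_assoc]
      exact (mul_le_mul' le_rfl hLq).trans ENNReal.mul_div_le
    obtain ⟨s, hs⟩ := DLB.exists_signed_regret (NoiseModel.ofCutoff d hρ hρ1 hδ hL) hδ
      (shiftRegular_cutoffGaussian L (2 * δ)) hk hkT he hρ hρ1 hT8 π
    exact ⟨DLB.signed (NoiseModel.ofCutoff d hρ hρ1 hδ hL) hδ s,
      DLB.isHardInstance_signed _ hδ s hd hρ hρ1 hdδ,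
      ⟨(√d * δ + L) / (1 - ρ), fun x hx => mem_closedBall_zero_iff.1 hx⟩, hs⟩
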